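/- **Setting.** Fix type constructors with arities. *Base types* are $B ::= \tau \mid C\,B\cdots B$ ($\tau$ a type variable), ground base types $b$ contain no variables, and $\bot$ is an additional bottom type. Write $B'\sqsubseteq B$ if $B'=\sigma B$ for some substitution $\sigma$; moreover $\bot\sqsubseteq B$ for every $B$, and $B\sqsubseteq\bot$ only for $B=\bot$. Types are considered up to renaming of variables. A *component library* $\Lambda$ assigns to each component $c$ a closed polytype $\forall\bar\tau.\,B'_1\to\cdots\to B'_m\to B'$. Its *type transformer* is $[\![c]\!](B_1,\dots,B_m)=\sigma B'$, where $\sigma$ is a most general unifier of the pairs $(B_i,B'_i)$, the variables of the signature and of each $B_i$ being renamed apart; it is $\bot$ if some $B_i=\bot$ or there is no unifier. An *abstract cover* $\mathcal A$ is a finite set of types that contains $\tau$ and $\bot$ and is closed under meet with respect to $\sqsubseteq$; $\alpha_{\mathcal A}(B)$ is the most specific $A\in\mathcal A$ with $B\sqsubseteq A$. *Terms* are $e::=x\mid c\mid e\,e$ and $E::=e\mid\lambda x.E$. *Abstract inference*: $\Gamma\vdash_{\mathcal A}x\Rightarrow\alpha_{\mathcal A}(b)$ if $\Gamma(x)=b$;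 and if $c$ has arity $m$ and $\Gamma\vdash_{\mathcal A}e_i\Rightarrow B_i$ for $i=1,\dots,m$, then $\Gamma\vdash_{\mathcal A}c\,e_1\cdots e_m\Rightarrow\alpha_{\mathcal A}([\![c]\!](B_1,\dots,B_m))$. *Abstract checking*: $\Gamma\vdash_{\mathcal A}\lambda x.E\Leftarrow b\to t$ if $\Gamma,x{:}b\vdash_{\mathcal A}E\Leftarrow t$; and $\Gamma\vdash_{\mathcal A}e\Leftarrow b$ if $\Gamma\vdash_{\mathcal A}e\Rightarrow B$ and $b\sqsubseteq B$. **The net.** Let $t=b_1\to\cdots\to b_n\to b$ be a ground type, $n\ge 0$. The *abstract transition net* $\mathcal N(\Lambda,t,\mathcal A)$ is the Petri net with set of places $P=\mathcal A\setminus\{\bot\}$, initial marking $I(p)=\#\{i:\alpha_{\mathcal A}(b_i)=p\}$, final places $\{p\in P: b\sqsubseteq p\}$, and the following transitions: for every component $c$ of arity $m$ and all places $A,A_1,\dots,A_m$ with $\alpha_{\mathcal A}([\![c]\!](A_1,\dots,A_m))=A$, a transition $(c;A_1,\dots,A_m\mapsto A)$ that takes one token from $A_j$ for each $j$ (with multiplicity)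 and puts one into $A$; and for every $p$ with $I(p)>0$ a copy transition (takes one token from $p$, returns two) and a delete transition (takes one token from $p$). A finite sequence $\pi$ of transitions is a *valid path*, $\pi\models\mathcal N(\Lambda,t,\mathcal A)$, if it fires from the marking $I$ to a marking with exactly one token in total, which lies in a final place. **Programs of a path.** For a finite sequence $\pi$ of transitions, $\mathrm{FromPath}(\pi)$ is the set of programs obtained by executing $\pi$ on tokens labelled by terms: start with, for each $i$, a token labelled $x_i$ in the place $\alpha_{\mathcal A}(b_i)$. A transition $(c;A_1,\dots,A_m\mapsto A)$ consumes tokens $e_1,\dots,e_m$ lying in $A_{s(1)},\dots,A_{s(m)}$, for any choice of the tokens in these places and any permutation $s$ such that $(c;A_{s(1)},\dots,A_{s(m)}\mapsto A)$ is again a transition, and puts a token $c\,e_1\cdots e_m$ into $A$. A copy transition duplicates some token of its place, and a delete transition removes one. If the execution ends with a single token, in any place, labelled $e$, then $\lambda x_1.\cdots\lambda x_n.\,e\in\mathrm{FromPath}(\pi)$. **Theorem 4.2 (ATN completeness).** Suppose $\cdot\vdash_{\mathcal A}E\Leftarrow t$. If $E\in\mathrm{FromPath}(\pi)$ for a finite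 sequence $\pi$ of transitions of $\mathcal N(\Lambda,t,\mathcal A)$, then $\pi\models\mathcal N(\Lambda,t,\mathcal A)$. Moreover, there is such a $\pi$ with $E\in\mathrm{FromPath}(\pi)$. -/

import Mathlib

universe u v w

namespace TYGAR

/-! ### Types

The type constructors, each with its arity, are the function symbols of a first-order language `L`.
Base types are first-order terms over them with type variables `τ₀, τ₁, …`; ground base types are
terms without variables. -/

/-- Base types `B ::= τ | C B ⋯ B`. -/
abbrev BaseTy (L : FirstOrder.Language.{u, v}) : Type u := L.Term ℕ

/-- Ground base types `b ::= C b ⋯ b`. -/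
abbrev GroundTy (L : FirstOrder.Language.{u, v}) : Type u := L.Term Empty

/-- Base types together with the bottom type. -/
abbrev BaseTyBot (L : FirstOrder.Language.{u, v}) : Type u := WithBot (BaseTy L)

/-- A ground base type, regarded as a base type. -/
def GroundTy.toBot {L : FirstOrder.Language.{u, v}} (b : GroundTy L) : BaseTyBot L :=
  ((b.relabel Empty.elim : BaseTy L) : WithBot (BaseTy L))

/-- First-order types `X | X → T` whose argument and result types are taken from `X`. -/
inductive FunTy (X : Type u) : Type u
  | base : X → FunTy X
  | arrow : X → FunTy X → FunTy X

/-- The argument types `b₁, …, bₙ` of `b₁ → ⋯ → bₙ → b`. -/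
def FunTy.args {X : Type u} : FunTy X → List X
  | .base _ => []
  | .arrow b t => b :: t.args

/-- The result type `b` of `b₁ → ⋯ → bₙ → b`. -/
def FunTy.res {X : Type u} : FunTy X → X
  | .base b => b
  | .arrow _ t => t.res

/-- The number of arguments. -/
def FunTy.arity {X : Type u} (t : FunTy X) : ℕ := t.args.length

/-- A component library assigns to each component a polytype `∀ τ₀ τ₁ …, T`; every type variable
that occurs in `T` is universally quantified. -/
abbrev Library (L : FirstOrder.Language.{u, v}) (C : Type w) : Type max u w := C → FunTy (BaseTy L)

/-! ### Type subsumption -/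

/-- `Subsumes a' a` is `a' ⊑ a`: the type `a'` is a substitution instance of `a`, and `⊥` lies
strictly below every other base type. -/
def Subsumes {L : FirstOrder.Language.{u, v}} : BaseTyBot L → BaseTyBot L → Prop
  | none, _ => True
  | some _, none => False
  | some T', some T => ∃ σ : ℕ → BaseTy L, T' = T.subst σ

/-- `m` is the meet of `a` and `b` in the type subsumption lattice (it is unique up to renaming of
type variables). -/
def IsMeet {L : FirstOrder.Language.{u, v}} (a b m : BaseTyBot L) : Prop :=
  Subsumes m a ∧ Subsumes m b ∧ ∀ x, Subsumes x a → Subsumes x b → Subsumes x m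

/-- An abstract cover: a finite set of base types that contains the top type `τ` and the bottom
type and is closed under meet. Types are considered up to renaming of type variables, so a cover
contains one representative of each of its classes. -/
structure AbstractCover (L : FirstOrder.Language.{u, v}) where
  carrier : Set (BaseTyBot L)
  finite : carrier.Finite
  top_mem : ∃ i : ℕ, ((FirstOrder.Language.Term.var i : BaseTy L) : WithBot (BaseTy L)) ∈ carrier
  bot_mem : ⊥ ∈ carrier
  meet_mem : ∀ a ∈ carrier, ∀ b ∈ carrier, ∃ m ∈ carrier, IsMeet a b m
  rep_unique : ∀ a ∈ carrier, ∀ b ∈ carrier, Subsumes a b → Subsumes b a → a = b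

/-- `IsAbstraction A B a` is `α_A(B) = a`: the most specific type in the cover that subsumes `B`
is `a`. -/
def IsAbstraction {L : FirstOrder.Language.{u, v}} (A : AbstractCover L) (B a : BaseTyBot L) : Prop :=
  a ∈ A.carrier ∧ Subsumes B a ∧ ∀ a' ∈ A.carrier, Subsumes B a' → Subsumes a a'

/-! ### Type transformers -/

/-- `σ` unifies the pairs `(l i, r i)`. -/
def Unifies {L : FirstOrder.Language.{u, v}} {V ι : Type} (l r : ι → L.Term V) (σ : V → BaseTy L) : Prop :=
  ∀ i, (l i).subst σ = (r i).subst σ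

/-- `σ` is a most general (proper) unifier of the pairs `(l i, r i)`. -/
def IsMGU {L : FirstOrder.Language.{u, v}} {V ι : Type} (l r : ι → L.Term V) (σ : V → BaseTy L) : Prop :=
  Unifies l r σ ∧
    ∀ σ' : V → BaseTy L, Unifies l r σ' → ∃ ρ : ℕ → BaseTy L, ∀ x, σ' x = (σ x).subst ρ

/-- Type variables for the unification problem of a component with `m` arguments: those of the
fresh instance of the signature, and those of each actual argument. The scope of a type variable is
the single type in which it occurs, so all of these are kept apart. -/
abbrev UVar (m : ℕ) : Type := ℕ ⊕ (Fin m × ℕ)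

/-- The `j`-th formal argument type in the fresh instance of the signature. -/
def formalArg {L : FirstOrder.Language.{u, v}} (T : FunTy (BaseTy L)) (j : Fin T.arity) :
    L.Term (UVar T.arity) :=
  (T.args.get j).relabel Sum.inl

/-- The `j`-th actual argument type, with its variables renamed apart. -/
def actualArg {L : FirstOrder.Language.{u, v}} {m : ℕ} (Bs : Fin m → BaseTy L) (j : Fin m) :
    L.Term (UVar m) :=
  (Bs j).relabel fun x => Sum.inr (j, x)

/-- `TransformerValue T Bs R` is `⟦c⟧(B₁, …, Bₘ) = R` for a component `c` of signature `T`
(`R` is determined up to renaming of type variables): `R = σ B'`, where `B'` is the formal result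
type and `σ` a most general unifier of the actual with the formal argument types. If an argument is
`⊥`, or if there is no proper unifier, then `σ` is the bottom substitution and `R = ⊥`. -/
inductive TransformerValue {L : FirstOrder.Language.{u, v}} (T : FunTy (BaseTy L)) :
    (Fin T.arity → BaseTyBot L) → BaseTyBot L → Prop
  | unify (Bs : Fin T.arity → BaseTy L) (σ : UVar T.arity → BaseTy L) :
      IsMGU (actualArg Bs) (formalArg T) σ →
      TransformerValue T (fun j => (Bs j : WithBot (BaseTy L)))
        (((T.res.relabel Sum.inl : L.Term (UVar T.arity)).subst σ : BaseTy L) :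
          WithBot (BaseTy L))
  | clash (Bs : Fin T.arity → BaseTy L) :
      (¬ ∃ σ, Unifies (actualArg Bs) (formalArg T) σ) →
      TransformerValue T (fun j => (Bs j : WithBot (BaseTy L))) ⊥
  | bot (Bs : Fin T.arity → BaseTyBot L) : (∃ j, Bs j = ⊥) → TransformerValue T Bs ⊥

/-- `AbsResult A T Bs a` is `α_A(⟦c⟧(B₁, …, Bₘ)) = a` for a component `c` of signature `T`. -/
def AbsResult {L : FirstOrder.Language.{u, v}} (A : AbstractCover L) (T : FunTy (BaseTy L))
    (Bs : Fin T.arity → BaseTyBot L) (a : BaseTyBot L) : Prop :=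
  ∃ R, TransformerValue T Bs R ∧ IsAbstraction A R a

/-! ### Terms and abstract type checking -/

/-- Application terms `e ::= x | c | e e`, with de Bruijn indices for the variables. -/
inductive AppTerm (C : Type w) : Type w
  | var : ℕ → AppTerm C
  | comp : C → AppTerm C
  | app : AppTerm C → AppTerm C → AppTerm C

/-- The application `c e₁ ⋯ eₘ`. -/
def AppTerm.applyComp {C : Type w} {m : ℕ} (c : C) (es : Fin m → AppTerm C) : AppTerm C :=
  (List.ofFn es).foldl AppTerm.app (AppTerm.comp c)

/-- Normal-form terms `E ::= e | λ x. E`. -/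
inductive NormalTerm (C : Type w) : Type w
  | body : AppTerm C → NormalTerm C
  | lam : NormalTerm C → NormalTerm C

/-- The term `λ x₁. ⋯ λ xₙ. e`. -/
def NormalTerm.lams {C : Type w} : ℕ → AppTerm C → NormalTerm C
  | 0, e => .body e
  | n + 1, e => .lam (lams n e)

/-- Abstract type inference `Γ ⊢_A e ⟹ B`. The environment lists the types of the variables,
innermost binder first. -/
inductive Infer {L : FirstOrder.Language.{u, v}} {C : Type w} (Λ : Library L C) (A : AbstractCover L)
    (Γ : List (GroundTy L)) : AppTerm C → BaseTyBot L → Prop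
  | var {i : ℕ} {b : GroundTy L} {a : BaseTyBot L} :
      Γ[i]? = some b → IsAbstraction A b.toBot a → Infer Λ A Γ (.var i) a
  | app {c : C} {es : Fin (Λ c).arity → AppTerm C} {Bs : Fin (Λ c).arity → BaseTyBot L}
      {a : BaseTyBot L} :
      (∀ j, Infer Λ A Γ (es j) (Bs j)) → AbsResult A (Λ c) Bs a →
      Infer Λ A Γ (AppTerm.applyComp c es) a

/-- Abstract type checking `Γ ⊢_A E ⟸ t`. -/
inductive Check {L : FirstOrder.Language.{u, v}} {C : Type w} (Λ : Library L C) (A : AbstractCover L) :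
    List (GroundTy L) → NormalTerm C → FunTy (GroundTy L) → Prop
  | lam {Γ : List (GroundTy L)} {b : GroundTy L} {E : NormalTerm C} {t : FunTy (GroundTy L)} :
      Check Λ A (b :: Γ) E t → Check Λ A Γ (.lam E) (.arrow b t)
  | base {Γ : List (GroundTy L)} {e : AppTerm C} {b : GroundTy L} {B : BaseTyBot L} :
      Infer Λ A Γ e B → Subsumes b.toBot B → Check Λ A Γ (.body e) (.base b)

/-! ### Petri nets -/

/-- A Petri net with places `P` and transitions `T`; `pre` and `post` are the multiplicities of the
edges from places to transitions and from transitions to places. -/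
structure PetriNet (P T : Type*) where
  pre : P → T → ℕ
  post : T → P → ℕ

/-- The transition firing `M₁ →[x] M₂`. -/
def PetriNet.Fires {P T : Type*} (N : PetriNet P T) (M₁ : P → ℕ) (x : T) (M₂ : P → ℕ) : Prop :=
  ∀ p, N.pre p x ≤ M₁ p ∧ M₂ p = M₁ p - N.pre p x + N.post x p

/-- The sequence of transitions is a path between two markings. -/
def PetriNet.IsPath {P T : Type*} (N : PetriNet P T) : (P → ℕ) → List T → (P → ℕ) → Prop
  | M, [], M' => M = M'
  | M, x :: π, M' => ∃ M₁, N.Fires M x M₁ ∧ N.IsPath M₁ π M'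

/-- A Petri net with an initial marking and a set of final places. -/
structure TransitionNet (P T : Type*) extends PetriNet P T where
  initial : P → ℕ
  final : Set P

/-- A valid final marking: exactly one token, and it lies in a final place. -/
def TransitionNet.ValidFinal {P T : Type*} (N : TransitionNet P T) (M : P → ℕ) : Prop :=
  ∃ f ∈ N.final, M f = 1 ∧ ∀ p, p ≠ f → M p = 0

/-- `π ⊨ N`: a path from the initial marking to a valid final marking. -/
def TransitionNet.ValidPath {P T : Type*} (N : TransitionNet P T) (π : List T) : Prop :=
  ∃ M, N.IsPath N.initial π M ∧ N.ValidFinal M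

/-! ### The abstract transition net -/

/-- The places: the types of the cover other than `⊥`. -/
abbrev Place {L : FirstOrder.Language.{u, v}} (A : AbstractCover L) : Type u :=
  {a : BaseTyBot L // a ∈ A.carrier ∧ a ≠ ⊥}

/-- The types of the query arguments, indexed by the de Bruijn indices of the corresponding
variables in the body of `λ x₁. ⋯ λ xₙ. e`. -/
def queryEnv {L : FirstOrder.Language.{u, v}} (t : FunTy (GroundTy L)) : List (GroundTy L) := t.args.reverse

/-- The initial marking: one token in `α_A(bᵢ)` for every query argument type `bᵢ`. -/
noncomputable def initialMarking {L : FirstOrder.Language.{u, v}} (t : FunTy (GroundTy L))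
    (A : AbstractCover L) (p : Place A) : ℕ :=
  Nat.card {i : Fin (queryEnv t).length // IsAbstraction A ((queryEnv t).get i).toBot p.1}

/-- The transitions: one for each component `c` and places `A₁, …, Aₘ` and `a` with
`α_A(⟦c⟧(A₁, …, Aₘ)) = a`, and a copy and a delete transition for each initial place. -/
inductive Transition {L : FirstOrder.Language.{u, v}} {C : Type w} (Λ : Library L C)
    (t : FunTy (GroundTy L)) (A : AbstractCover L) : Type max u w
  | comp (c : C) (inp : Fin (Λ c).arity → Place A) (out : Place A)
      (h : AbsResult A (Λ c) (fun j => (inp j).1) out.1) : Transition Λ t A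
  | copy (p : Place A) (h : 0 < initialMarking t A p) : Transition Λ t A
  | delete (p : Place A) (h : 0 < initialMarking t A p) : Transition Λ t A

open Classical in
/-- The abstract transition net of the abstract synthesis problem `(Λ, t, A)`. -/
noncomputable def atn {L : FirstOrder.Language.{u, v}} {C : Type w} (Λ : Library L C)
    (t : FunTy (GroundTy L)) (A : AbstractCover L) :
    TransitionNet (Place A) (Transition Λ t A) where
  pre p x := match x with
    | .comp _ inp _ _ => (Finset.univ.filter fun j => inp j = p).card
    | .copy q _ => if p = q then 1 else 0
    | .delete q _ => if p = q then 1 else 0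
  post x p := match x with
    | .comp _ _ out _ => if p = out then 1 else 0
    | .copy q _ => if p = q then 2 else 0
    | .delete _ _ => 0
  initial := initialMarking t A
  final := {p | Subsumes t.res.toBot p.1}

/-! ### From paths to programs

A path is executed on tokens that carry programs. -/

/-- A token: an application term that lies in a place. -/
abbrev Token {L : FirstOrder.Language.{u, v}} (C : Type w) (A : AbstractCover L) : Type max u w :=
  AppTerm C × Place A

/-- The effect of a transition on the tokens. A transition of the component `c` consumes tokens
`e₁, …, eₘ` from its input places, in any choice of tokens from these places, and puts
`c e₁ ⋯ eₘ` into its output place. The terms may be passed to `c` in any order that is a transition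
of `c` with the same output place, since the edges of a transition are not ordered. A copy
transition duplicates some token of its place, and a delete transition removes one. -/
inductive TokenStep {L : FirstOrder.Language.{u, v}} {C : Type w} {Λ : Library L C}
    {t : FunTy (GroundTy L)} {A : AbstractCover L} :
    Transition Λ t A → Multiset (Token C A) → Multiset (Token C A) → Prop
  | comp (c : C) (inp : Fin (Λ c).arity → Place A) (out : Place A)
      (h : AbsResult A (Λ c) (fun j => (inp j).1) out.1)
      (es : Fin (Λ c).arity → AppTerm C) (s : Equiv.Perm (Fin (Λ c).arity))
      (hs : AbsResult A (Λ c) (fun j => (inp (s j)).1) out.1) (S : Multiset (Token C A)) :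
      TokenStep (.comp c inp out h)
        ((Finset.univ.val.map fun j => ((es j, inp (s j)) : Token C A)) + S)
        ((AppTerm.applyComp c es, out) ::ₘ S)
  | copy (p : Place A) (h : 0 < initialMarking t A p) (e : AppTerm C)
      (S : Multiset (Token C A)) :
      TokenStep (.copy p h) ((e, p) ::ₘ S) ((e, p) ::ₘ (e, p) ::ₘ S)
  | delete (p : Place A) (h : 0 < initialMarking t A p) (e : AppTerm C)
      (S : Multiset (Token C A)) :
      TokenStep (.delete p h) ((e, p) ::ₘ S) S

/-- The effect of a sequence of transitions on the tokens. -/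
def TokenRun {L : FirstOrder.Language.{u, v}} {C : Type w} {Λ : Library L C}
    {t : FunTy (GroundTy L)} {A : AbstractCover L} :
    Multiset (Token C A) → List (Transition Λ t A) → Multiset (Token C A) → Prop
  | S, [], S' => S = S'
  | S, x :: π, S' => ∃ S₁, TokenStep x S S₁ ∧ TokenRun S₁ π S'

/-- The programs that correspond to a sequence `π` of transitions: start with one token for each
query argument `xᵢ`, labelled by `xᵢ`, in the place `α_A(bᵢ)`; if running `π` leaves a single token,
in whatever place, and it is labelled by `e`, then `λ x₁. ⋯ λ xₙ. e` is such a program. -/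
def fromPath {L : FirstOrder.Language.{u, v}} {C : Type w} {Λ : Library L C}
    {t : FunTy (GroundTy L)} {A : AbstractCover L} (π : List (Transition Λ t A)) :
    Set (NormalTerm C) :=
  {E | ∃ (pl : Fin (queryEnv t).length → Place A) (e : AppTerm C) (p : Place A),
    (∀ i, IsAbstraction A ((queryEnv t).get i).toBot (pl i).1) ∧
    TokenRun (Finset.univ.val.map fun i => ((AppTerm.var i.1, pl i) : Token C A)) π {(e, p)} ∧
    E = NormalTerm.lams t.arity e}

end TYGAR

namespace TYGAR

variable {L : FirstOrder.Language.{u, v}} {C : Type w}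

/-! ### Subsumption and abstraction -/

/-! Validity rests on an invariant: every token `(e, p)` reached from the query arguments satisfies
`Infer e p` (`TokenRun.infer`). Inference is deterministic (`Infer.unique`), so the place of the
last token is the type by which the body of `E` was checked, hence a final place. Erasing the labels
turns a run into a firing sequence (`TokenRun.isPath`). Determinism comes down to two facts: most
general unifiers are instances of one another, and a cover has one representative per renaming
class.

For existence, the inference derivation is replayed bottom-up. It uses a multiset of argument
tokens, one for each variable occurrence (`Infer.exists_tokenRun`). Copy and delete transitions, run
beforehand, supply that multiset (`exists_tokenRun_argTokens`). No subterm has type `⊥`, because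
transformers are strict and the type of the body subsumes a ground type; so all intermediate types
are places. -/

theorem Subsumes.trans {a b c : BaseTyBot L} (hab : Subsumes a b) (hbc : Subsumes b c) :
    Subsumes a c := by
  match a, b, c, hab, hbc with
  | none, _, _, _, _ => exact trivial
  | some _, some _, some T, ⟨σ, h⟩, ⟨ρ, h'⟩ =>
    subst h'
    subst h
    refine ⟨fun x => (ρ x).subst σ, ?_⟩
    induction T with
    | var i => rfl
    | func f ts ih => simp only [FirstOrder.Language.Term.subst, ih]

theorem Subsumes.eq_bot {a : BaseTyBot L} (h : Subsumes a ⊥) : a = ⊥ := by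
  match a, h with
  | none, _ => rfl

theorem GroundTy.toBot_ne_bot (b : GroundTy L) : b.toBot ≠ ⊥ := WithBot.coe_ne_bot

theorem Subsumes.ne_bot {b : GroundTy L} {a : BaseTyBot L} (h : Subsumes b.toBot a) : a ≠ ⊥ := by
  rintro rfl
  exact b.toBot_ne_bot h.eq_bot

theorem subsumes_refl (a : BaseTyBot L) : Subsumes a a := by
  match a with
  | none => exact trivial
  | some T =>
    refine ⟨FirstOrder.Language.Term.var, ?_⟩
    induction T with
    | var i => rfl
    | func f ts ih => simp only [FirstOrder.Language.Term.subst, ← ih]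

theorem subsumes_var (a : BaseTyBot L) (i : ℕ) :
    Subsumes a ((FirstOrder.Language.Term.var i : BaseTy L) : WithBot (BaseTy L)) := by
  match a with
  | none => exact trivial
  | some T => exact ⟨fun _ => T, rfl⟩

/-- Two types `B`, `B'` are allowed because transformer values are determined only up to renaming.
-/
theorem IsAbstraction.unique {A : AbstractCover L} {B B' a a' : BaseTyBot L}
    (h : IsAbstraction A B a) (h' : IsAbstraction A B' a') (hB : Subsumes B B')
    (hB' : Subsumes B' B) : a = a' :=
  A.rep_unique a h.1 a' h'.1 (h.2.2 a' h'.1 (hB.trans h'.2.1)) (h'.2.2 a h.1 (hB'.trans h.2.1))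

/-- The abstraction is the meet of the finitely many cover elements above `B`, accumulated from the
top type, which makes the family nonempty. -/
theorem exists_isAbstraction (A : AbstractCover L) (B : BaseTyBot L) :
    ∃ a, IsAbstraction A B a := by
  have key : ∀ s : Set (BaseTyBot L), s.Finite → s ⊆ A.carrier →
      ∃ m ∈ A.carrier, Subsumes B m ∧ ∀ a ∈ s, Subsumes B a → Subsumes m a := by
    intro s hs
    induction s, hs using Set.Finite.induction_on with
    | empty =>
      obtain ⟨i, hi⟩ := A.top_mem
      exact fun _ => ⟨_, hi, subsumes_var B i, fun _ h => absurd h (Set.notMem_empty _)⟩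
    | @insert x s _ _ ih =>
      intro hsub
      obtain ⟨m, hm, hBm, hmin⟩ := ih fun y hy => hsub (Set.mem_insert_of_mem _ hy)
      by_cases hx : Subsumes B x
      · obtain ⟨k, hk, hkm, hkx, hmeet⟩ := A.meet_mem m hm x (hsub (Set.mem_insert _ _))
        refine ⟨k, hk, hmeet B hBm hx, ?_⟩
        rintro a (rfl | ha) hBa
        · exact hkx
        · exact hkm.trans (hmin a ha hBa)
      · refine ⟨m, hm, hBm, ?_⟩
        rintro a (rfl | ha) hBa
        · exact absurd hBa hx
        · exact hmin a ha hBa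
  obtain ⟨m, hm, hBm, hmin⟩ := key A.carrier A.finite subset_rfl
  exact ⟨m, hm, hBm, hmin⟩

/-! ### Type transformers are functional up to renaming -/

theorem IsMGU.subsumes_subst {V ι : Type} {l r : ι → L.Term V} {σ σ' : V → BaseTy L}
    (h : IsMGU l r σ) (h' : Unifies l r σ') (T : L.Term V) :
    Subsumes ((T.subst σ' : BaseTy L) : WithBot (BaseTy L))
      ((T.subst σ : BaseTy L) : WithBot (BaseTy L)) := by
  obtain ⟨ρ, hρ⟩ := h.2 σ' h'
  refine ⟨ρ, ?_⟩
  induction T with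
  | var i => exact hρ i
  | func f ts ih => simp only [FirstOrder.Language.Term.subst, ih]

theorem coe_args_injective {m : ℕ} {Bs Bs' : Fin m → BaseTy L}
    (h : (fun j => (Bs j : WithBot (BaseTy L))) = fun j => (Bs' j : WithBot (BaseTy L))) :
    Bs = Bs' :=
  funext fun j => WithBot.coe_injective (congrFun h j)

theorem TransformerValue.subsumes {T : FunTy (BaseTy L)} {Bs : Fin T.arity → BaseTyBot L}
    {R R' : BaseTyBot L} (h : TransformerValue T Bs R) (h' : TransformerValue T Bs R') :
    Subsumes R R' := by
  cases h with
  | clash => exact trivial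
  | bot => exact trivial
  | unify Bs σ hσ =>
    -- The index is a family of coercions, which `cases` cannot unify; `hX` keeps the equation for
    -- use in each case.
    generalize hX : (fun j => (Bs j : WithBot (BaseTy L))) = X at h'
    cases h' with
    | unify Bs' σ' hσ' =>
      obtain rfl := coe_args_injective hX
      exact hσ'.subsumes_subst hσ.1 _
    | clash Bs' hno =>
      obtain rfl := coe_args_injective hX
      exact absurd ⟨σ, hσ.1⟩ hno
    | bot _ hb =>
      obtain ⟨j, hj⟩ := hb
      exact absurd ((congrFun hX j).trans hj) WithBot.coe_ne_bot

theorem AbsResult.unique {A : AbstractCover L} {T : FunTy (BaseTy L)}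
    {Bs : Fin T.arity → BaseTyBot L} {a a' : BaseTyBot L}
    (h : AbsResult A T Bs a) (h' : AbsResult A T Bs a') : a = a' := by
  obtain ⟨R, hR, ha⟩ := h
  obtain ⟨R', hR', ha'⟩ := h'
  exact ha.unique ha' (hR.subsumes hR') (hR'.subsumes hR)

/-- Strictness: a `⊥` argument forces the value `⊥`, which abstracts to itself because `⊥` lies in
the cover. -/
theorem AbsResult.arg_ne_bot {A : AbstractCover L} {T : FunTy (BaseTy L)}
    {Bs : Fin T.arity → BaseTyBot L} {a : BaseTyBot L}
    (h : AbsResult A T Bs a) (ha : a ≠ ⊥) (j : Fin T.arity) : Bs j ≠ ⊥ := by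
  intro hj
  obtain ⟨R, hR, hRa⟩ := h
  have hR' : Subsumes R ⊥ := hR.subsumes (.bot Bs ⟨j, hj⟩)
  exact ha (hRa.2.2 ⊥ A.bot_mem hR').eq_bot

/-! ### Terms -/

/-- The component at the head of an application term, if there is one. -/
def AppTerm.head? : AppTerm C → Option C
  | .var _ => none
  | .comp c => some c
  | .app f _ => f.head?

/-- The arguments to which the head of an application term is applied. -/
def AppTerm.args : AppTerm C → List (AppTerm C)
  | .var _ => []
  | .comp _ => []
  | .app f e => f.args ++ [e]

theorem AppTerm.head?_foldl (l : List (AppTerm C)) (f : AppTerm C) :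
    (l.foldl AppTerm.app f).head? = f.head? := by
  induction l generalizing f with
  | nil => rfl
  | cons e l ih => exact ih (f.app e)

theorem AppTerm.args_foldl (l : List (AppTerm C)) (f : AppTerm C) :
    (l.foldl AppTerm.app f).args = f.args ++ l := by
  induction l generalizing f with
  | nil => simp
  | cons e l ih => simp [ih, AppTerm.args]

/-- Since `applyComp` is a fold and not a constructor, `head?` and `args` serve to recover `c` and
`es` when an inference is inverted. -/
theorem AppTerm.head?_applyComp {m : ℕ} (c : C) (es : Fin m → AppTerm C) :
    (applyComp c es).head? = some c :=
  head?_foldl _ _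

theorem AppTerm.args_applyComp {m : ℕ} (c : C) (es : Fin m → AppTerm C) :
    (applyComp c es).args = List.ofFn es :=
  args_foldl _ _

theorem NormalTerm.lams_injective (n : ℕ) :
    Function.Injective (lams n : AppTerm C → NormalTerm C) := by
  induction n with
  | zero => exact fun _ _ h => NormalTerm.body.inj h
  | succ n ih => exact fun _ _ h => ih (NormalTerm.lam.inj h)

/-! ### Abstract typing -/

theorem Infer.unique {Λ : Library L C} {A : AbstractCover L} {Γ : List (GroundTy L)}
    {e : AppTerm C} {B B' : BaseTyBot L} (h : Infer Λ A Γ e B) (h' : Infer Λ A Γ e B') :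
    B = B' := by
  induction h generalizing B' with
  | @var i b a hi ha =>
    generalize he : AppTerm.var i = e at h'
    cases h' with
    | var hi' ha' =>
      cases he
      obtain rfl := Option.some.inj (hi.symm.trans hi')
      exact ha.unique ha' (subsumes_refl _) (subsumes_refl _)
    | app =>
      have := congrArg AppTerm.head? he
      rw [AppTerm.head?_applyComp] at this
      cases this
  | @app c es Bs a _ ha ih =>
    generalize he : AppTerm.applyComp c es = e at h'
    cases h' with
    | var =>
      have := congrArg AppTerm.head? he
      rw [AppTerm.head?_applyComp] at this
      cases this
    | @app c' es' Bs' _ hes' ha' =>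
      have hc := congrArg AppTerm.head? he
      rw [AppTerm.head?_applyComp, AppTerm.head?_applyComp] at hc
      cases hc
      have hargs := congrArg AppTerm.args he
      rw [AppTerm.args_applyComp, AppTerm.args_applyComp] at hargs
      obtain rfl := List.ofFn_injective hargs
      obtain rfl : Bs = Bs' := funext fun j => ih j (hes' j)
      exact ha.unique ha'

theorem Infer.mem_carrier {Λ : Library L C} {A : AbstractCover L} {Γ : List (GroundTy L)}
    {e : AppTerm C} {B : BaseTyBot L} (h : Infer Λ A Γ e B) : B ∈ A.carrier := by
  cases h with
  | var _ ha => exact ha.1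
  | app _ ha => obtain ⟨R, _, hR⟩ := ha; exact hR.1

theorem Check.exists_infer {Λ : Library L C} {A : AbstractCover L} {Γ : List (GroundTy L)}
    {E : NormalTerm C} {t : FunTy (GroundTy L)} (h : Check Λ A Γ E t) :
    ∃ e B, E = NormalTerm.lams t.arity e ∧ Infer Λ A (queryEnv t ++ Γ) e B ∧
      Subsumes t.res.toBot B := by
  induction h with
  | @base Γ e b B hi hs => exact ⟨e, B, rfl, hi, hs⟩
  | @lam Γ b E t _ ih =>
    obtain ⟨e, B, rfl, hi, hs⟩ := ih
    refine ⟨e, B, rfl, ?_, hs⟩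
    -- Reversal matches the binder order: `(b :: t.args).reverse ++ Γ = t.args.reverse ++ (b :: Γ)`.
    simpa [queryEnv, FunTy.args] using hi

/-! ### Token runs are paths -/

section Runs

variable {Λ : Library L C} {t : FunTy (GroundTy L)} {A : AbstractCover L}

open Classical in
/-- The marking that counts the tokens in each place. -/
noncomputable def tokenMarking (S : Multiset (Token C A)) (p : Place A) : ℕ :=
  (S.map Prod.snd).count p

theorem TokenStep.fires {x : Transition Λ t A} {S S' : Multiset (Token C A)}
    (h : TokenStep x S S') : (atn Λ t A).Fires (tokenMarking S) x (tokenMarking S') := by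
  classical
  intro p
  cases h with
  | comp c inp out h es s hs S =>
    have hcount : ((Finset.univ.val.map
        fun j => ((es j, inp (s j)) : Token C A)).map Prod.snd).count p =
        (Finset.univ.filter fun j => inp j = p).card := by
      rw [Multiset.map_map, Multiset.count_map]
      -- Permuting the arguments by `s` does not change how many tokens each place loses.
      refine Finset.card_bij (s := Finset.univ.filter fun j => p = inp (s j))
        (fun j _ => s j) ?_ (fun _ _ _ _ h => s.injective h) ?_
      · intro j hj
        simpa [eq_comm] using hj
      · intro j hj
        exact ⟨s.symm j, by simpa [eq_comm] using hj, by simp⟩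
    simp only [tokenMarking, Multiset.map_add, Multiset.count_add, hcount, Multiset.map_cons,
      Multiset.count_cons, atn]
    constructor
    · convert Nat.le_add_right _ _
    · have : (Finset.univ.filter fun j => inp j = p).card + (S.map Prod.snd).count p -
          (Finset.univ.filter fun j => inp j = p).card = (S.map Prod.snd).count p := by omega
      convert congrArg (· + if p = out then 1 else 0) this.symm
  | copy q _ e S =>
    simp only [tokenMarking, Multiset.map_cons, Multiset.count_cons, atn]
    split_ifs <;> omega
  | delete q _ e S =>
    simp only [tokenMarking, Multiset.map_cons, Multiset.count_cons, atn]
    split_ifs <;> omega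

theorem TokenRun.isPath {π : List (Transition Λ t A)} {S S' : Multiset (Token C A)}
    (h : TokenRun S π S') : (atn Λ t A).IsPath (tokenMarking S) π (tokenMarking S') := by
  induction π generalizing S with
  | nil => exact congrArg tokenMarking h
  | cons x π ih =>
    obtain ⟨S₁, h₁, h₂⟩ := h
    exact ⟨_, h₁.fires, ih h₂⟩

theorem TokenRun.append {π π' : List (Transition Λ t A)} {S S' S'' : Multiset (Token C A)}
    (h : TokenRun S π S') (h' : TokenRun S' π' S'') : TokenRun S (π ++ π') S'' := by
  induction π generalizing S with
  | nil => obtain rfl : S = S' := h; exact h'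
  | cons x π ih =>
    obtain ⟨S₁, h₁, h₂⟩ := h
    exact ⟨S₁, h₁, ih h₂⟩

/-- Soundness of one step. For a component, `hs` is exactly the premise of the application rule for
the permuted inputs. -/
theorem TokenStep.infer {Γ : List (GroundTy L)} {x : Transition Λ t A}
    {S S' : Multiset (Token C A)} (h : TokenStep x S S')
    (hS : ∀ k ∈ S, Infer Λ A Γ k.1 k.2.1) : ∀ k ∈ S', Infer Λ A Γ k.1 k.2.1 := by
  cases h with
  | comp c inp out h es s hs S =>
    intro k hk
    rcases Multiset.mem_cons.1 hk with rfl | hk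
    · exact .app (fun j => hS (es j, inp (s j)) (Multiset.mem_add.2 (.inl
        (Multiset.mem_map.2 ⟨j, Finset.mem_univ j, rfl⟩)))) hs
    · exact hS k (Multiset.mem_add.2 (.inr hk))
  | copy q _ e S =>
    intro k hk
    rcases Multiset.mem_cons.1 hk with rfl | hk
    · exact hS _ (Multiset.mem_cons_self _ _)
    · exact hS k hk
  | delete q _ e S => exact fun k hk => hS k (Multiset.mem_cons_of_mem hk)

theorem TokenRun.infer {Γ : List (GroundTy L)} {π : List (Transition Λ t A)}
    {S S' : Multiset (Token C A)} (h : TokenRun S π S')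
    (hS : ∀ k ∈ S, Infer Λ A Γ k.1 k.2.1) : ∀ k ∈ S', Infer Λ A Γ k.1 k.2.1 := by
  induction π generalizing S with
  | nil => obtain rfl : S = S' := h; exact hS
  | cons x π ih =>
    obtain ⟨S₁, h₁, h₂⟩ := h
    exact ih h₂ (h₁.infer hS)

/-! ### The tokens of the query arguments -/

/-- The token of a query argument. -/
def argToken (C : Type w) (pl : Fin (queryEnv t).length → Place A)
    (i : Fin (queryEnv t).length) : Token C A :=
  (AppTerm.var i.1, pl i)

variable {pl : Fin (queryEnv t).length → Place A}

theorem tokenMarking_argTokens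
    (hpl : ∀ i, IsAbstraction A ((queryEnv t).get i).toBot (pl i).1) :
    tokenMarking (Finset.univ.val.map (argToken C pl)) = initialMarking t A := by
  classical
  funext p
  rw [tokenMarking, initialMarking, Multiset.map_map, Multiset.count_map,
    Nat.card_eq_fintype_card, Fintype.card_subtype]
  change (Finset.univ.filter fun i => p = pl i).card = _
  congr 1
  refine Finset.filter_congr fun i _ => ?_
  constructor
  · rintro rfl
    exact hpl i
  · exact fun h => Subtype.ext (h.unique (hpl i) (subsumes_refl _) (subsumes_refl _))

theorem infer_argTokens
    (hpl : ∀ i, IsAbstraction A ((queryEnv t).get i).toBot (pl i).1) :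
    ∀ k ∈ Finset.univ.val.map (argToken C pl), Infer Λ A (queryEnv t) k.1 k.2.1 := by
  intro k hk
  obtain ⟨i, _, rfl⟩ := Multiset.mem_map.1 hk
  exact .var (List.getElem?_eq_getElem i.2) (hpl i)

theorem initialMarking_pos
    (hpl : ∀ i, IsAbstraction A ((queryEnv t).get i).toBot (pl i).1)
    (i : Fin (queryEnv t).length) : 0 < initialMarking t A (pl i) :=
  Nat.card_pos_iff.2 ⟨⟨⟨i, hpl i⟩⟩, inferInstance⟩

/-! ### Construction of runs -/

/-- Runs on disjoint parts of the tokens can be executed one after another. -/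
theorem exists_tokenRun_sum {ι : Type*} (s : Finset ι) (S S' : ι → Multiset (Token C A))
    (h : ∀ i ∈ s, ∃ π : List (Transition Λ t A), ∀ R, TokenRun (S i + R) π (S' i + R)) :
    ∃ π : List (Transition Λ t A), ∀ R, TokenRun (∑ i ∈ s, S i + R) π (∑ i ∈ s, S' i + R) := by
  classical
  induction s using Finset.induction_on with
  | empty => exact ⟨[], fun R => rfl⟩
  | insert i s hi ih =>
    obtain ⟨π, hπ⟩ := ih fun j hj => h j (Finset.mem_insert_of_mem hj)
    obtain ⟨π', hπ'⟩ := h i (Finset.mem_insert_self i s)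
    refine ⟨π' ++ π, fun R => ?_⟩
    rw [Finset.sum_insert hi, Finset.sum_insert hi]
    have h₁ := hπ' (∑ j ∈ s, S j + R)
    have h₂ := hπ (S' i + R)
    -- Each run takes the tokens of the other as its frame: unprocessed ones for `π'`, finished ones
    -- for `π`.
    rw [add_left_comm, add_left_comm _ (S' i)] at h₂
    rw [add_assoc, add_assoc]
    exact h₁.append h₂

theorem exists_tokenRun_replicate {p : Place A} (hp : 0 < initialMarking t A p)
    (e : AppTerm C) (k : ℕ) :
    ∃ π : List (Transition Λ t A), ∀ R, TokenRun ({(e, p)} + R) π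
      (Multiset.replicate k (e, p) + R) := by
  cases k with
  | zero => exact ⟨[.delete p hp], fun R => ⟨R, .delete p hp e R, (zero_add R).symm⟩⟩
  | succ k =>
    -- One token is already present, so the base case is a single copy and needs no transition.
    induction k with
    | zero => exact ⟨[], fun R => rfl⟩
    | succ k ih =>
      obtain ⟨π, hπ⟩ := ih
      refine ⟨π ++ [.copy p hp], fun R => (hπ R).append ?_⟩
      simp only [Multiset.replicate_succ, Multiset.cons_add]
      exact ⟨_, .copy p hp e _, rfl⟩

theorem sum_singleton_eq_map {ι α : Type*} (s : Finset ι) (f : ι → α) :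
    ∑ i ∈ s, ({f i} : Multiset α) = s.val.map f := by
  rw [← Multiset.sum_map_singleton (s.val.map f), Multiset.map_map]
  rfl

theorem sum_replicate_count {ι : Type*} [Fintype ι] [DecidableEq ι] (V : Multiset ι) :
    ∑ i, Multiset.replicate (V.count i) i = V := by
  ext i
  simp [Multiset.count_sum', Multiset.count_replicate]

/-- `V` prescribes how often each argument is used; arguments are adjusted independently, each to
its multiplicity in `V`. -/
theorem exists_tokenRun_argTokens
    (hpl : ∀ i, IsAbstraction A ((queryEnv t).get i).toBot (pl i).1)
    (V : Multiset (Fin (queryEnv t).length)) :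
    ∃ π : List (Transition Λ t A),
      TokenRun (Finset.univ.val.map (argToken C pl)) π (V.map (argToken C pl)) := by
  obtain ⟨π, hπ⟩ := exists_tokenRun_sum (Λ := Λ) (t := t) Finset.univ
    (fun i => {argToken C pl i}) (fun i => Multiset.replicate (V.count i) (argToken C pl i))
    fun i _ => exists_tokenRun_replicate (initialMarking_pos hpl i) _ _
  refine ⟨π, ?_⟩
  have h := hπ 0
  rw [add_zero, add_zero, sum_singleton_eq_map] at h
  have hV := congrArg (Multiset.map (argToken C pl)) (sum_replicate_count V)
  rw [← Multiset.coe_mapAddMonoidHom, map_sum] at hV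
  simp only [Multiset.coe_mapAddMonoidHom, Multiset.map_replicate] at hV
  rwa [hV] at h

/-- `V` collects the variable occurrences of `e`. The path is chosen before the frame `R`, so that
the runs for sibling arguments can be concatenated. -/
theorem Infer.exists_tokenRun
    (hpl : ∀ i, IsAbstraction A ((queryEnv t).get i).toBot (pl i).1)
    {e : AppTerm C} {B : BaseTyBot L} (h : Infer Λ A (queryEnv t) e B) (hB : B ≠ ⊥) :
    ∃ (V : Multiset (Fin (queryEnv t).length)) (π : List (Transition Λ t A)), ∀ R,
      TokenRun (V.map (argToken C pl) + R) π ({(e, ⟨B, h.mem_carrier, hB⟩)} + R) := by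
  induction h with
  | @var i b a hi ha =>
    obtain ⟨hlt, rfl⟩ := List.getElem?_eq_some_iff.1 hi
    refine ⟨{⟨i, hlt⟩}, [], fun R => ?_⟩
    obtain rfl : a = (pl ⟨i, hlt⟩).1 :=
      ha.unique (hpl ⟨i, hlt⟩) (subsumes_refl _) (subsumes_refl _)
    rfl
  | @app c es Bs a hes ha ih =>
    have hBs := ha.arg_ne_bot hB
    choose V π hπ using fun j => ih j (hBs j)
    let inp : Fin (Λ c).arity → Place A := fun j => ⟨Bs j, (hes j).mem_carrier, hBs j⟩
    obtain ⟨π', hπ'⟩ := exists_tokenRun_sum (Λ := Λ) (t := t) Finset.univ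
      (fun j => (V j).map (argToken C pl)) (fun j => {(es j, inp j)}) fun j _ => ⟨π j, hπ j⟩
    have ha' := ha
    obtain ⟨_, _, hmem⟩ := ha'
    let out : Place A := ⟨a, hmem.1, hB⟩
    refine ⟨∑ j, V j, π' ++ [.comp c inp out ha], fun R => ?_⟩
    have h₁ := hπ' R
    rw [sum_singleton_eq_map] at h₁
    have h₂ : (∑ j, V j).map (argToken C pl) = ∑ j, (V j).map (argToken C pl) :=
      map_sum (Multiset.mapAddMonoidHom (argToken C pl)) V Finset.univ
    rw [h₂]
    -- The arguments already come in the order of the transition, so the permutation is the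
    -- identity.
    exact h₁.append ⟨_, .comp c inp out ha es 1 ha R, rfl⟩

end Runs

end TYGAR

theorem theorem4p2 {L : FirstOrder.Language.{u, v}} {C : Type w}
    (Λ : TYGAR.Library L C) (t : TYGAR.FunTy (TYGAR.GroundTy L)) (A : TYGAR.AbstractCover L)
    (E : TYGAR.NormalTerm C) (hE : TYGAR.Check Λ A [] E t) :
    (∀ π : List (TYGAR.Transition Λ t A),
      E ∈ TYGAR.fromPath π → (TYGAR.atn Λ t A).ValidPath π) ∧
    ∃ π : List (TYGAR.Transition Λ t A), E ∈ TYGAR.fromPath π := by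
  classical
  obtain ⟨e, B, rfl, he, hB⟩ := hE.exists_infer
  rw [List.append_nil] at he
  constructor
  · rintro π ⟨pl, e', p, hpl, hrun, hEq⟩
    obtain rfl := TYGAR.NormalTerm.lams_injective _ hEq
    have hp : TYGAR.Infer Λ A (TYGAR.queryEnv t) e p.1 :=
      hrun.infer (TYGAR.infer_argTokens hpl) (e, p) (Multiset.mem_singleton_self _)
    have hpath := hrun.isPath
    refine ⟨_, TYGAR.tokenMarking_argTokens (C := C) hpl ▸ hpath, p, ?_, ?_, ?_⟩
    · rw [he.unique hp] at hB
      exact hB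
    · simp [TYGAR.tokenMarking]
    · intro q hq
      simp [TYGAR.tokenMarking, hq]
  · choose a ha using fun i => TYGAR.exists_isAbstraction A ((TYGAR.queryEnv t).get i).toBot
    let pl : Fin (TYGAR.queryEnv t).length → TYGAR.Place A :=
      -- A type above a ground type is not `⊥`, so these abstractions are places.
      fun i => ⟨a i, (ha i).1, (ha i).2.1.ne_bot⟩
    obtain ⟨V, π, hπ⟩ := he.exists_tokenRun (pl := pl) ha hB.ne_bot
    obtain ⟨π', hπ'⟩ := TYGAR.exists_tokenRun_argTokens (C := C) (Λ := Λ) (pl := pl) ha V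
    have h := hπ 0
    rw [add_zero, add_zero] at h
    exact ⟨π' ++ π, pl, e, _, ha, hπ'.append h, rfl⟩
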